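/- Let $n\ge 1$ and let $\{K_t\}_{t\in[0,T)}$ be a family of smooth, strictly convex bodies in $\mathbb{R}^n$ (compact convex sets with non-empty interior whose boundary is a smooth hypersurface with positive definite second fundamental form), each with the origin in its interior. For a smooth function $f$ on $\mathbb{S}^{n-1}$ let $\bar\nabla$ denote the Levi-Civita connection (and the gradient) of the standard metric $\bar g$ of $\mathbb{S}^{n-1}$, and put $$\sigma_{n-1}[f]=\frac{\det\left(\bar\nabla_i\bar\nabla_j f+\bar g_{ij}f\right)}{\det \bar g_{ij}}.$$ Suppose that the support functions $s(z,t)=\max_{y\in K_t}\langle z,y\rangle$ are smooth on $\mathbb{S}^{n-1}\times[0,T)$ and solve the Gauss curvature flow in support-function form, $$\partial_t s=-\frac{1}{\sigma_{n-1}[s]}\quad\text{on }\mathbb{S}^{n-1}\times[0,T).$$ Then the polar bodies $K_t^*=\{x\in\mathbb{R}^n:\langle x,y\rangle\le 1\text{ for all }y\in K_t\}$, $t\in[0,T)$, are smooth, strictly convex bodies with the origin in their interiors, their support functions $s^*(z,t)=\max_{y\in K_t^*}\langle z,y\rangle$ are smooth on $\mathbb{S}^{n-1}\times[0,T)$, and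 $$\partial_t s^*=\frac{(s^*)^{n+2}\,\sigma_{n-1}[s^*]}{\left((s^*)^2+\|\bar\nabla s^*\|_{\bar g}^2\right)^{n/2}}\quad\text{on }\mathbb{S}^{n-1}\times[0,T).$$ (At $t=0$ time derivatives are one-sided.) -/

import Mathlib

open scoped ContDiff RealInnerProductSpace

noncomputable section

namespace GaussFlow

/-- Euclidean space `ℝⁿ`. -/
abbrev E (n : ℕ) : Type := EuclideanSpace ℝ (Fin n)

/-- The support function `s_K(z) = sup_{y ∈ K} ⟨z, y⟩` (used at unit vectors `z`). -/
def supp {n : ℕ} (K : Set (E n)) (z : E n) : ℝ :=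
  sSup ((fun y : E n => ⟪z, y⟫) '' K)

/-- The polar body `K* = {x : ⟨x, y⟩ ≤ 1 for all y ∈ K}`. -/
def polarBody {n : ℕ} (K : Set (E n)) : Set (E n) :=
  {x | ∀ y ∈ K, ⟪x, y⟫ ≤ 1}

/-- A smooth, strictly convex body: compact, convex, with non-empty interior, whose boundary is a
smooth hypersurface with positive definite second fundamental form. Near each boundary point `x`
the body is `{ρ ≤ 0}` for a smooth `ρ` with `dρ ≠ 0`, and the second fundamental form at `x`, for
the outer normal, is the restriction of `D²ρ(x) / |dρ(x)|` to the tangent space `ker dρ(x)`. -/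
structure IsSmoothStrictlyConvexBody {n : ℕ} (K : Set (E n)) : Prop where
  isCompact : IsCompact K
  convex : Convex ℝ K
  nonempty_interior : (interior K).Nonempty
  smooth_boundary : ∀ x ∈ frontier K, ∃ (U : Set (E n)) (ρ : E n → ℝ),
    IsOpen U ∧ x ∈ U ∧ ContDiffOn ℝ ∞ ρ U ∧ K ∩ U = {y ∈ U | ρ y ≤ 0} ∧
    fderiv ℝ ρ x ≠ 0 ∧
    ∀ v : E n, v ≠ 0 → fderiv ℝ ρ x v = 0 → 0 < fderiv ℝ (fderiv ℝ ρ) x v v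

/-- The extension `x ↦ f (x / |x|)` to `ℝⁿ \ {0}` of a function on the unit sphere; only the values
of `f` on the sphere enter. A function on the sphere is smooth iff this extension is smooth on
`ℝⁿ \ {0}`, and derivatives of `f` in tangent directions are those of the extension. -/
def radialExt {n : ℕ} {F : Type*} (f : E n → F) (x : E n) : F :=
  f (‖x‖⁻¹ • x)

/-- The gradient on the unit sphere, as a vector of `ℝⁿ` tangent to the sphere at `z`. -/
def sphGrad {n : ℕ} (f : E n → ℝ) (z : E n) : E n :=
  gradient (radialExt f) z

/-- The tangent space `z^⊥` of the unit sphere at `z`. -/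
abbrev tangent {n : ℕ} (z : E n) : Submodule ℝ (E n) := (ℝ ∙ z)ᗮ

/-- The Levi-Civita connection of the unit sphere: for a tangent vector field `Y`, the covariant
derivative of `Y` at `z` in the tangent direction `v` is the tangential part of `D_v Y`. -/
def covDeriv {n : ℕ} (Y : E n → E n) (z : E n) : tangent z →ₗ[ℝ] tangent z :=
  ((tangent z).orthogonalProjectionOnto ∘L fderiv ℝ (radialExt Y) z ∘L (tangent z).subtypeL :
    tangent z →L[ℝ] tangent z)

/-- The tensor `𝔯 = ∇̄²f + f ḡ` at `z`, with one index raised by the metric `ḡ`, that is, the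
endomorphism `v ↦ ∇̄_v (∇̄f) + f v` of the tangent space of the sphere. -/
def curvOp {n : ℕ} (f : E n → ℝ) (z : E n) : tangent z →ₗ[ℝ] tangent z :=
  covDeriv (sphGrad f) z + f z • LinearMap.id

/-- `σ_{n-1} = det (∇̄_i ∇̄_j f + ḡ_ij f) / det ḡ_ij`. -/
def sigma {n : ℕ} (f : E n → ℝ) (z : E n) : ℝ :=
  LinearMap.det (curvOp f z)

/-- The bodies `K t`, `t ∈ [0, T)`, form a smooth family of smooth, strictly convex bodies with the
origin in their interiors, whose support functions `s(z, t)` are smooth on `S^{n-1} × [0, T)` and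
satisfy `∂_t s = speed s` there (the time derivative at `t = 0` is one-sided). -/
structure EvolvesBy {n : ℕ} (speed : (E n → ℝ) → E n → ℝ) (T : ℝ) (K : ℝ → Set (E n)) : Prop where
  body : ∀ t ∈ Set.Ico 0 T, IsSmoothStrictlyConvexBody (K t)
  zero_mem : ∀ t ∈ Set.Ico 0 T, 0 ∈ interior (K t)
  smooth : ContDiffOn ℝ ∞ (fun p : E n × ℝ => radialExt (supp (K p.2)) p.1)
    ({0}ᶜ ×ˢ Set.Ico 0 T)
  evolution : ∀ t ∈ Set.Ico 0 T, ∀ z ∈ Metric.sphere (0 : E n) 1,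
    HasDerivWithinAt (fun τ => supp (K τ) z) (speed (supp (K t)) z) (Set.Ico 0 T) t

end GaussFlow

end

/-! Let `Φ_K(x) = s(x) ∇s(x) = ∇(s²/2)(x)` be the duality map of a body `K` with support function
`s`, extended to `ℝⁿ` by homogeneity. On `ℝⁿ \ {0}` it is inverted by the duality map of the polar
body. At a unit vector `x` its Jacobian determinant is `s(x)ⁿ⁺¹ σ[s](x)`, so at dual points the
Jacobians multiply to `1` and `σ[s]` is expressed through `σ[s*]`.

The gauge description `s*(z) = max_x ⟪z, x⟫ / s(x)`, with the maximum attained at the point `y` with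
`Φ_K(y) = z`, turns `∂_t s` into `∂_t s*` by the envelope theorem: `∂_t s*(z) = -∂_t s(y)`. The
maximizer `y`, and with it `s*`, depends smoothly on `(z, t)` by the inverse function theorem for
`(x, t) ↦ (Φ_{K_t}(x), t)`. -/

noncomputable section

namespace GaussFlow

open Set Filter Topology
open scoped Pointwise

section Gradient

variable {V : Type*} [NormedAddCommGroup V] [InnerProductSpace ℝ V] [CompleteSpace V]
  {f : V → ℝ} {x : V}

theorem contDiffAt_gradient {m k : WithTop ℕ∞} (hf : ContDiffAt ℝ k f x) (hmk : m + 1 ≤ k) :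
    ContDiffAt ℝ m (gradient f) x :=
  (InnerProductSpace.toDual ℝ V).symm.contDiff.contDiffAt.comp x (hf.fderiv_right hmk)

theorem differentiableAt_gradient (hf : ContDiffAt ℝ 2 f x) : DifferentiableAt ℝ (gradient f) x :=
  (contDiffAt_gradient (m := 1) hf (by norm_num)).differentiableAt one_ne_zero

theorem inner_fderiv_gradient (hf : ContDiffAt ℝ 2 f x) (v w : V) :
    ⟪fderiv ℝ (gradient f) x v, w⟫ = fderiv ℝ (fderiv ℝ f) x v w := by
  have hd : DifferentiableAt ℝ (fderiv ℝ f) x :=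
    (hf.fderiv_right (m := 1) (by norm_num)).differentiableAt one_ne_zero
  have h : HasFDerivAt (gradient f) _ x :=
    (InnerProductSpace.toDual ℝ V).symm.toContinuousLinearEquiv.hasFDerivAt.comp x
      hd.hasFDerivAt
  rw [h.fderiv]
  exact InnerProductSpace.toDual_symm_apply

theorem inner_fderiv_gradient_comm (hf : ContDiffAt ℝ 2 f x) (v w : V) :
    ⟪fderiv ℝ (gradient f) x v, w⟫ = ⟪fderiv ℝ (gradient f) x w, v⟫ := by
  rw [inner_fderiv_gradient hf, inner_fderiv_gradient hf]
  exact hf.isSymmSndFDerivAt (by simp) v w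

end Gradient

section Homogeneous

variable {V W : Type*} [NormedAddCommGroup V] [NormedSpace ℝ V] [NormedAddCommGroup W]
  [NormedSpace ℝ W] {k : ℕ} {F : V → W} {x : V}

/-- Positive homogeneity of degree `k`, that is, homogeneity with respect to positive scalars. -/
def PosHomogeneous (k : ℕ) (F : V → W) : Prop :=
  ∀ ⦃c : ℝ⦄, 0 < c → ∀ x, F (c • x) = c ^ k • F x

theorem PosHomogeneous.fderiv_smul (hF : PosHomogeneous (k + 1) F) {c : ℝ} (hc : 0 < c) (x : V) :
    fderiv ℝ F (c • x) = c ^ k • fderiv ℝ F x := by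
  have hcomp : (fun y => F (c • y)) = c ^ (k + 1) • F := funext fun y => hF hc y
  have hderiv : fderiv ℝ (fun y => F (c • y)) x = c • fderiv ℝ F (c • x) := fderiv_comp_smul c
  rw [hcomp, fderiv_const_smul_field, pow_succ', mul_smul] at hderiv
  exact (smul_right_injective _ hc.ne' hderiv).symm

theorem PosHomogeneous.fderiv_apply_self (hF : PosHomogeneous k F) (hd : DifferentiableAt ℝ F x) :
    fderiv ℝ F x x = (k : ℝ) • F x := by
  have hray : HasDerivAt (fun c : ℝ => c • x) x 1 := by
    simpa only [id, one_smul] using (hasDerivAt_id (1 : ℝ)).smul_const x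
  have hchain : HasDerivAt (fun c : ℝ => F (c • x)) (fderiv ℝ F x x) 1 := by
    refine HasFDerivAt.comp_hasDerivAt (1 : ℝ) ?_ hray
    simpa only [one_smul] using hd.hasFDerivAt
  have hpow : HasDerivAt (fun c : ℝ => c ^ k • F x) ((k : ℝ) • F x) 1 := by
    simpa only [one_pow, mul_one] using (hasDerivAt_pow k (1 : ℝ)).smul_const (F x)
  refine hchain.unique (hpow.congr_of_eventuallyEq ?_)
  filter_upwards [lt_mem_nhds one_pos] with c hc using hF hc x

end Homogeneous

section HomogeneousGradient

variable {V : Type*} [NormedAddCommGroup V] [InnerProductSpace ℝ V] [CompleteSpace V] {k : ℕ}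
  {F : V → ℝ} {x : V}

theorem posHomogeneous_gradient (hF : PosHomogeneous (k + 1) F) :
    PosHomogeneous k (gradient F) := by
  intro c hc x
  simp only [gradient, hF.fderiv_smul hc, map_smulₛₗ, conj_trivial]

theorem PosHomogeneous.inner_gradient_self (hF : PosHomogeneous k F)
    (hd : DifferentiableAt ℝ F x) : ⟪gradient F x, x⟫ = k * F x := by
  rw [inner_gradient_left, hF.fderiv_apply_self hd, smul_eq_mul]

theorem PosHomogeneous.fderiv_gradient_self (hF : PosHomogeneous 1 F) (hs : ContDiffAt ℝ 2 F x) :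
    fderiv ℝ (gradient F) x x = 0 := by
  rw [(posHomogeneous_gradient hF).fderiv_apply_self (differentiableAt_gradient hs),
    Nat.cast_zero, zero_smul]

theorem PosHomogeneous.inner_fderiv_gradient_self (hF : PosHomogeneous 1 F)
    (hs : ContDiffAt ℝ 2 F x) (v : V) : ⟪x, fderiv ℝ (gradient F) x v⟫ = 0 := by
  rw [real_inner_comm, inner_fderiv_gradient_comm hs, hF.fderiv_gradient_self hs, inner_zero_left]

end HomogeneousGradient

section Determinant

variable {V : Type*} [NormedAddCommGroup V] [InnerProductSpace ℝ V] [FiniteDimensional ℝ V]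

theorem det_add_smulRight_of_orthogonal {z : V} (hz : ‖z‖ = 1) {B : V →ₗ[ℝ] V}
    {C : (ℝ ∙ z)ᗮ →ₗ[ℝ] (ℝ ∙ z)ᗮ} (hBz : B z = 0) (hC : ∀ v, (C v : V) = B v) :
    LinearMap.det (B + (innerₛₗ ℝ z).smulRight z) = LinearMap.det C := by
  let e := Submodule.prodEquivOfIsCompl (ℝ ∙ z) (ℝ ∙ z)ᗮ (Submodule.isCompl_orthogonal _)
  have hconj : e.toLinearMap ∘ₗ LinearMap.id.prodMap C ∘ₗ e.symm.toLinearMap =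
      B + (innerₛₗ ℝ z).smulRight z := by
    rw [← LinearMap.comp_assoc, LinearEquiv.comp_toLinearMap_symm_eq]
    refine LinearMap.ext fun ⟨w, v⟩ => ?_
    obtain ⟨c, hc⟩ := Submodule.mem_span_singleton.1 w.2
    have hzv : ⟪z, v⟫ = 0 := Submodule.mem_orthogonal_singleton_iff_inner_right.1 v.2
    simp [e, ← hc, hC, hBz, hz, hzv, inner_add_right, real_inner_smul_right, add_comm]
  rw [← hconj, LinearMap.det_conj, LinearMap.det_prodMap, LinearMap.det_id, one_mul]

theorem det_smulRight_add_smul {p z : V} (hz : ‖z‖ = 1) (hpz : ⟪p, z⟫ ≠ 0) {B : V →ₗ[ℝ] V}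
    (hBz : B z = 0) (hzB : ∀ w, ⟪z, B w⟫ = 0) :
    LinearMap.det ((innerₛₗ ℝ p).smulRight p + ⟪p, z⟫ • B) =
      ⟪p, z⟫ ^ (Module.finrank ℝ V + 1) *
        LinearMap.det (B + (innerₛₗ ℝ z).smulRight z) := by
  have hzz : ⟪z, z⟫ = 1 := by rw [real_inner_self_eq_norm_sq, hz, one_pow]
  -- As `B` kills `z` and has its range in `zᗮ`, one row and one column operation replace `p` by `z`
  -- in the rank-one term.
  have hfactor : (innerₛₗ ℝ p).smulRight p + ⟪p, z⟫ • B =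
      LinearMap.transvection (innerₛₗ ℝ z) (p - z) ∘ₗ
        (⟪p, z⟫ • (B + (innerₛₗ ℝ z).smulRight z)) ∘ₗ
          LinearMap.transvection (innerₛₗ ℝ (⟪p, z⟫⁻¹ • p - z)) z := by
    ext1 u
    simp only [LinearMap.comp_apply, LinearMap.transvection.apply, LinearMap.add_apply,
      LinearMap.smul_apply, LinearMap.smulRight_apply, innerₛₗ_apply_apply, map_add, map_smul,
      inner_sub_left, real_inner_smul_left, hBz, hzB, hzz, inner_zero_right]
    match_scalars <;> field_simp <;> ring
  rw [hfactor, LinearMap.det_comp, LinearMap.det_comp, LinearMap.transvection.det,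
    LinearMap.transvection.det, LinearMap.det_smul]
  simp only [innerₛₗ_apply_apply, inner_sub_left, inner_sub_right, real_inner_smul_left, hzz,
    real_inner_comm p z, inv_mul_cancel₀ hpz]
  ring

end Determinant

section Sphere

variable {n : ℕ} {F : E n → ℝ} {z : E n}

theorem radialExt_of_posHomogeneous {V : Type*} [NormedAddCommGroup V] [NormedSpace ℝ V] {k : ℕ}
    {F : E n → V} (hF : PosHomogeneous k F) {x : E n} (hx : x ≠ 0) :
    radialExt F x = ‖x‖⁻¹ ^ k • F x :=
  hF (inv_pos.2 (norm_pos_iff.2 hx)) x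

theorem sphGrad_of_posHomogeneous (hF : PosHomogeneous 1 F) (hd : DifferentiableAt ℝ F z)
    (hz : ‖z‖ = 1) : sphGrad F z = gradient F z - F z • z := by
  have hz0 : z ≠ 0 := norm_ne_zero_iff.1 (hz ▸ one_ne_zero)
  have hnorm : HasFDerivAt (fun x : E n => ‖x‖) (innerSL ℝ z) z := by
    have h := (hasStrictFDerivAt_norm_sq z).hasFDerivAt.sqrt (by positivity)
    simpa [Real.sqrt_sq (norm_nonneg _), hz, two_smul, ← mul_two, smul_smul, ← add_smul] using h
  have hext : HasFDerivAt (radialExt F) (fderiv ℝ F z - F z • innerSL ℝ z) z := by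
    have h := ((hasDerivAt_inv (norm_ne_zero_iff.2 hz0)).comp_hasFDerivAt z hnorm).mul
      hd.hasFDerivAt
    refine HasFDerivAt.congr_of_eventuallyEq (h.congr_fderiv ?_) ?_
    · simp [hz, sub_eq_add_neg]
    · filter_upwards [isOpen_compl_singleton.mem_nhds hz0] with x hx
      rw [radialExt_of_posHomogeneous hF hx, pow_one]
      rfl
  refine ext_inner_right ℝ fun v => ?_
  simp only [sphGrad, inner_gradient_left, hext.fderiv, inner_sub_left, real_inner_smul_left,
    sub_apply, smul_apply, innerSL_apply_apply, smul_eq_mul]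

theorem sq_add_norm_sphGrad_sq (hF : PosHomogeneous 1 F) (hd : DifferentiableAt ℝ F z)
    (hz : ‖z‖ = 1) : F z ^ 2 + ‖sphGrad F z‖ ^ 2 = ‖gradient F z‖ ^ 2 := by
  have hEuler := hF.inner_gradient_self hd
  rw [sphGrad_of_posHomogeneous hF hd hz, norm_sub_sq_real, real_inner_smul_right, hEuler,
    norm_smul, hz, Real.norm_eq_abs, mul_one, sq_abs]
  push_cast
  ring

theorem radialExt_sphGrad_of_posHomogeneous (hF : PosHomogeneous 1 F)
    (hs : DifferentiableOn ℝ F {0}ᶜ) {x : E n} (hx : x ≠ 0) :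
    radialExt (sphGrad F) x = gradient F x - (‖x‖⁻¹ ^ 2 * F x) • x := by
  have hunit : ‖‖x‖⁻¹ • x‖ = 1 := norm_smul_inv_norm (𝕜 := ℝ) hx
  have hne : ‖x‖⁻¹ • x ≠ 0 := norm_ne_zero_iff.1 (hunit ▸ one_ne_zero)
  have hc : 0 < ‖x‖⁻¹ := inv_pos.2 (norm_pos_iff.2 hx)
  rw [radialExt, sphGrad_of_posHomogeneous hF
    (hs.differentiableAt (isOpen_compl_singleton.mem_nhds hne)) hunit,
    posHomogeneous_gradient hF hc, hF hc, pow_zero, one_smul, pow_one, smul_eq_mul, smul_smul]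
  ring_nf

theorem curvOp_apply_of_posHomogeneous (hF : PosHomogeneous 1 F) (hs : ContDiffOn ℝ ∞ F {0}ᶜ)
    (hz : ‖z‖ = 1) (v : tangent z) : (curvOp F z v : E n) = fderiv ℝ (gradient F) z v := by
  have hz0 : z ≠ 0 := norm_ne_zero_iff.1 (hz ▸ one_ne_zero)
  have hnhds : {0}ᶜ ∈ 𝓝 z := isOpen_compl_singleton.mem_nhds hz0
  have hFz : ContDiffAt ℝ ∞ F z := hs.contDiffAt hnhds
  have hFz2 : ContDiffAt ℝ 2 F z := hFz.of_le (by norm_cast)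
  have hcoef : DifferentiableAt ℝ (fun x : E n => ‖x‖⁻¹ ^ 2 * F x) z :=
    (((contDiffAt_norm ℝ hz0 (n := 1)).differentiableAt one_ne_zero).inv
      (norm_ne_zero_iff.2 hz0) |>.pow 2).mul (hFz.differentiableAt (by simp))
  have hfield : HasFDerivAt (radialExt (sphGrad F)) _ z :=
    ((differentiableAt_gradient hFz2).hasFDerivAt.sub
      (hcoef.hasFDerivAt.smul (hasFDerivAt_id z))).congr_of_eventuallyEq <|
        eventually_of_mem hnhds fun x hx =>
          radialExt_sphGrad_of_posHomogeneous hF (hs.differentiableOn (by simp)) hx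
  have hproj_z : (tangent z).orthogonalProjectionOnto z = 0 := by
    rw [Submodule.orthogonalProjectionOnto_eq_zero_iff]
    exact Submodule.le_orthogonal_orthogonal _ (Submodule.mem_span_singleton_self z)
  have htangent : fderiv ℝ (gradient F) z v ∈ tangent z :=
    Submodule.mem_orthogonal_singleton_iff_inner_right.2 (hF.inner_fderiv_gradient_self hFz2 v)
  have hproj : (tangent z).orthogonalProjectionOnto (fderiv ℝ (gradient F) z v) =
      ⟨_, htangent⟩ := Submodule.orthogonalProjectionOnto_mem_subspace_eq_self ⟨_, htangent⟩
  have hcov : covDeriv (sphGrad F) z v = ⟨_, htangent⟩ - F z • v := by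
    simp [covDeriv, hfield.fderiv, hproj, hproj_z, hz]
  simp [curvOp, hcov]

theorem det_fderiv_smul_gradient (hF : PosHomogeneous 1 F) (hs : ContDiffOn ℝ ∞ F {0}ᶜ)
    (hz : ‖z‖ = 1) (hFz : F z ≠ 0) :
    LinearMap.det (fderiv ℝ (fun x => F x • gradient F x) z : E n →ₗ[ℝ] E n) =
      F z ^ (n + 1) * sigma F z := by
  have hz0 : z ≠ 0 := norm_ne_zero_iff.1 (hz ▸ one_ne_zero)
  have hsz : ContDiffAt ℝ 2 F z :=
    (hs.contDiffAt (isOpen_compl_singleton.mem_nhds hz0)).of_le (by norm_cast)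
  have hd : DifferentiableAt ℝ F z := hsz.differentiableAt two_ne_zero
  have hEuler : ⟪gradient F z, z⟫ = F z := by
    rw [hF.inner_gradient_self hd, Nat.cast_one, one_mul]
  have hderiv : (fderiv ℝ (fun x => F x • gradient F x) z : E n →ₗ[ℝ] E n) =
      (innerₛₗ ℝ (gradient F z)).smulRight (gradient F z) +
        ⟪gradient F z, z⟫ • (fderiv ℝ (gradient F) z : E n →ₗ[ℝ] E n) := by
    ext1 u
    rw [ContinuousLinearMap.coe_coe, (hd.hasFDerivAt.fun_smul
      (differentiableAt_gradient hsz).hasFDerivAt).fderiv]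
    simp [inner_gradient_left, hEuler, add_comm]
  rw [hderiv, det_smulRight_add_smul hz (hEuler.symm ▸ hFz) (hF.fderiv_gradient_self hsz)
    (hF.inner_fderiv_gradient_self hsz), det_add_smulRight_of_orthogonal hz
    (hF.fderiv_gradient_self hsz) (curvOp_apply_of_posHomogeneous hF hs hz), hEuler,
    finrank_euclideanSpace_fin, sigma]

end Sphere

section LagrangeMultiplier

theorem tendsto_add_smul_nhdsGT_zero {V : Type*} [NormedAddCommGroup V] [NormedSpace ℝ V]
    (x u : V) : Tendsto (fun r : ℝ => x + r • u) (𝓝[>] 0) (𝓝 x) := by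
  have hcont : Continuous fun r : ℝ => x + r • u := by fun_prop
  simpa only [zero_smul, add_zero] using (hcont.tendsto 0).mono_left nhdsWithin_le_nhds

theorem eventually_lt_apply_add_smul {V : Type*} [NormedAddCommGroup V] [NormedSpace ℝ V]
    {f : V → ℝ} {f' : V →L[ℝ] ℝ} {x u : V} (hf : HasFDerivAt f f' x) (hu : 0 < f' u) :
    ∀ᶠ r : ℝ in 𝓝[>] 0, f x < f (x + r • u) := by
  have hderiv : HasDerivAt (fun r : ℝ => f (x + r • u)) (f' u) 0 := hf.hasLineDerivAt u
  have hslope := (hasDerivWithinAt_iff_tendsto_slope' self_notMem_Ioi).1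
    (hderiv.hasDerivWithinAt (s := Ioi 0))
  filter_upwards [hslope.eventually (lt_mem_nhds hu), self_mem_nhdsWithin] with r hr hr0
  simpa only [zero_smul, add_zero] using (slope_pos_iff hr0).1 hr

variable {V : Type*} [NormedAddCommGroup V] [InnerProductSpace ℝ V]

theorem sameRay_of_forall_inner_nonpos {p q : V} (h : ∀ u, ⟪q, u⟫ < 0 → ⟪p, u⟫ ≤ 0) :
    SameRay ℝ p q := by
  rw [sameRay_iff_norm_smul_eq, eq_comm, ← inner_eq_norm_mul_iff_real]
  refine (real_inner_le_norm p q).antisymm (not_lt.1 fun hlt => ?_)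
  obtain ⟨hp, hq⟩ : 0 < ‖p‖ ∧ 0 < ‖q‖ := by
    constructor <;> rw [norm_pos_iff] <;> rintro rfl <;> simp at hlt
  refine (h (‖q‖ • p - ‖p‖ • q) ?_).not_gt ?_ <;>
    rw [inner_sub_right, real_inner_smul_right, real_inner_smul_right, real_inner_self_eq_norm_sq]
  · rw [real_inner_comm]
    nlinarith
  · nlinarith

theorem sameRay_of_isLocalMaxOn_sublevel [CompleteSpace V] {f ρ : V → ℝ} {p q y : V}
    (hf : HasGradientAt f p y) (hρ : HasGradientAt ρ q y)
    (hmax : IsLocalMaxOn f {k | ρ k ≤ ρ y} y) : SameRay ℝ p q := by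
  refine sameRay_of_forall_inner_nonpos fun u hqu => not_lt.1 fun hpu => ?_
  have hρlt := eventually_lt_apply_add_smul hρ.hasFDerivAt.neg (u := u) (neg_pos.2 hqu)
  have hflt := eventually_lt_apply_add_smul hf.hasFDerivAt hpu
  have hmax' := (tendsto_add_smul_nhdsGT_zero y u).eventually (eventually_nhdsWithin_iff.1 hmax)
  obtain ⟨r, hρr, hfr, hr⟩ := (hρlt.and (hflt.and hmax')).exists
  exact hfr.not_ge (hr (neg_lt_neg_iff.1 hρr).le)

theorem inner_apply_self_nonneg_of_monotone {G : V → V} {G' : V →L[ℝ] V} {x : V}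
    (hG : HasFDerivAt G G' x) (hmono : ∀ᶠ y in 𝓝 x, 0 ≤ ⟪G y - G x, y - x⟫) (v : V) :
    0 ≤ ⟪G' v, v⟫ := by
  by_contra! hneg
  have hderiv : HasFDerivAt (fun y => -⟪v, G y - G x⟫) (-(innerSL ℝ v ∘L G')) x :=
    ((innerSL ℝ v).hasFDerivAt.comp x (hG.sub_const (G x))).neg
  have hlt := eventually_lt_apply_add_smul hderiv (u := v) (by
    simpa [real_inner_comm] using hneg)
  obtain ⟨r, hlt, hmono, hr⟩ := (hlt.and (((tendsto_add_smul_nhdsGT_zero x v).eventually hmono).and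
    self_mem_nhdsWithin)).exists
  rw [add_sub_cancel_left, real_inner_smul_right, real_inner_comm] at hmono
  rw [sub_self, inner_zero_right, neg_zero, neg_pos] at hlt
  exact hlt.not_ge (nonneg_of_mul_nonneg_right hmono hr)

theorem mem_frontier_of_isMaxOn_inner {K : Set V} {x y : V} (hx : x ≠ 0) (hy : y ∈ K)
    (hmax : IsMaxOn (fun k => ⟪x, k⟫) K y) : y ∈ frontier K := by
  refine ⟨subset_closure hy, fun hint => hx ?_⟩
  have hzero := (hmax.isLocalMax (mem_interior_iff_mem_nhds.1 hint)).hasFDerivAt_eq_zero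
    (innerSL ℝ x).hasFDerivAt
  exact inner_self_eq_zero.1 (congrArg (fun L : V →L[ℝ] ℝ => L x) hzero)

theorem mem_span_singleton_of_eventually_sameRay {M : V → V} {M' : V →L[ℝ] V} {x v : V}
    (hM : HasFDerivAt M M' x) (hx : x ≠ 0) (hMx : M x ≠ 0)
    (hray : ∀ᶠ y in 𝓝 x, SameRay ℝ y (M y)) (hv : M' v = 0) : v ∈ ℝ ∙ x := by
  have hnorm : DifferentiableAt ℝ (fun y : V => ‖y‖) x := differentiableAt_id.norm ℝ hx
  have hnormM : DifferentiableAt ℝ (fun y : V => ‖M y‖) x := hM.differentiableAt.norm ℝ hMx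
  have hderiv := (hnorm.hasFDerivAt.fun_smul hM).unique
    ((hnormM.hasFDerivAt.fun_smul (hasFDerivAt_id x)).congr_of_eventuallyEq
      (hray.mono fun y hy => hy.norm_smul_eq))
  have hMx_mem : M x ∈ ℝ ∙ x := by
    rw [← Submodule.smul_mem_iff _ (norm_ne_zero_iff.2 hx), hray.self_of_nhds.norm_smul_eq]
    exact Submodule.smul_mem _ _ (Submodule.mem_span_singleton_self x)
  have hderiv_v := congrArg (fun L : V →L[ℝ] V => L v) hderiv
  simp only [add_apply, smul_apply, hv, smul_zero, zero_add,
    ContinuousLinearMap.smulRight_apply, ContinuousLinearMap.id_apply, id] at hderiv_v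
  rw [← Submodule.smul_mem_iff _ (norm_ne_zero_iff.2 hMx), ← sub_eq_of_eq_add hderiv_v]
  exact Submodule.sub_mem _ (Submodule.smul_mem _ _ hMx_mem)
    (Submodule.smul_mem _ _ (Submodule.mem_span_singleton_self x))

end LagrangeMultiplier

section NormalField

variable {V : Type*} [NormedAddCommGroup V] [InnerProductSpace ℝ V] [CompleteSpace V] {K : Set V}

/-- The boundary of `K` is a smooth hypersurface with `K` locally on one side of it: near each
boundary point `K` is the sublevel set of a smooth function with non-vanishing differential. -/
def HasSmoothBoundary (K : Set V) : Prop :=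
  ∀ x ∈ frontier K, ∃ (U : Set V) (ρ : V → ℝ), IsOpen U ∧ x ∈ U ∧ ContDiffOn ℝ ∞ ρ U ∧
    K ∩ U = {y ∈ U | ρ y ≤ 0} ∧ fderiv ℝ ρ x ≠ 0

theorem HasSmoothBoundary.exists_normalField (hK : HasSmoothBoundary K) {y : V}
    (hy : y ∈ frontier K) :
    ∃ N : V → V, DifferentiableAt ℝ N y ∧ N y ≠ 0 ∧
      ∀ᶠ y' in 𝓝 y, y' ∈ K → ∀ x, IsMaxOn (fun k => ⟪x, k⟫) K y' → SameRay ℝ x (N y') := by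
  obtain ⟨U, ρ, hU, hyU, hρ, hKU, hρ0⟩ := hK y hy
  refine ⟨gradient ρ, differentiableAt_gradient ((hρ.contDiffAt (hU.mem_nhds hyU)).of_le
    (by norm_cast)), ?_, ?_⟩
  · rwa [gradient, ne_eq, LinearIsometryEquiv.map_eq_zero_iff]
  · filter_upwards [hU.mem_nhds hyU] with y' hy'U hy'K x hmax
    have hρy' : ρ y' ≤ 0 := (hKU.subset ⟨hy'K, hy'U⟩).2
    refine sameRay_of_isLocalMaxOn_sublevel (f := fun k => ⟪x, k⟫) ?_
      ((hρ.contDiffAt (hU.mem_nhds hy'U)).differentiableAt (by simp)).hasGradientAt ?_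
    · exact (innerSL ℝ x).hasFDerivAt
    · refine eventually_nhdsWithin_iff.2 ?_
      filter_upwards [hU.mem_nhds hy'U] with k hkU hk
      exact hmax (hKU.superset ⟨hkU, le_trans hk hρy'⟩).1

theorem HasSmoothBoundary.sameRay_of_isMaxOn (hK : HasSmoothBoundary K) {x x' y : V} (hx : x ≠ 0)
    (hy : y ∈ K) (hmax : IsMaxOn (fun k => ⟪x, k⟫) K y)
    (hmax' : IsMaxOn (fun k => ⟪x', k⟫) K y) : SameRay ℝ x x' := by
  obtain ⟨N, -, hN0, hN⟩ :=
    hK.exists_normalField (mem_frontier_of_isMaxOn_inner hx hy hmax)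
  have hray := hN.self_of_nhds hy
  exact (hray x hmax).trans (hray x' hmax').symm fun h => absurd h hN0

end NormalField

section SupportFunction

variable {n : ℕ} {K : Set (E n)} {z y : E n}

theorem inner_le_supp (hK : IsCompact K) (z : E n) (hy : y ∈ K) : ⟪z, y⟫ ≤ supp K z :=
  le_csSup (hK.image (f := fun y : E n => ⟪z, y⟫) (by fun_prop)).bddAbove (mem_image_of_mem _ hy)

theorem exists_inner_eq_supp (hK : IsCompact K) (hne : K.Nonempty) (z : E n) :
    ∃ y ∈ K, ⟪z, y⟫ = supp K z :=
  (hK.image (f := fun y : E n => ⟪z, y⟫) (by fun_prop)).sSup_mem (hne.image _)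

theorem isMaxOn_inner_of_eq_supp (hK : IsCompact K) (hzy : ⟪z, y⟫ = supp K z) :
    IsMaxOn (fun k => ⟪z, k⟫) K y :=
  fun _ hk => (inner_le_supp hK z hk).trans_eq hzy.symm

theorem posHomogeneous_supp (K : Set (E n)) : PosHomogeneous 1 (supp K) := by
  intro c hc z
  have himage : (fun y : E n => ⟪c • z, y⟫) '' K = c • ((fun y : E n => ⟪z, y⟫) '' K) := by
    simp only [← image_smul, image_image, real_inner_smul_left, smul_eq_mul]
  rw [supp, himage, Real.sSup_smul_of_nonneg hc.le, pow_one, supp]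

theorem supp_pos (hK : IsCompact K) (h0 : 0 ∈ interior K) (hz : z ≠ 0) : 0 < supp K z := by
  by_contra! hnonpos
  refine (mem_frontier_of_isMaxOn_inner hz (interior_subset h0) fun k hk => ?_).2 h0
  exact (inner_le_supp hK z hk).trans (hnonpos.trans_eq (inner_zero_right z).symm)

theorem gradient_supp_eq (hK : IsCompact K) (hy : y ∈ K) (hzy : ⟪z, y⟫ = supp K z)
    (hd : DifferentiableAt ℝ (supp K) z) : gradient (supp K) z = y := by
  have hmin : IsLocalMin (fun x => supp K x - ⟪y, x⟫) z := by
    refine Eventually.of_forall fun x => ?_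
    simp only [real_inner_comm, hzy, sub_self, sub_nonneg]
    exact real_inner_comm x y ▸ inner_le_supp hK x hy
  have hzero := hmin.hasFDerivAt_eq_zero (hd.hasFDerivAt.sub (innerSL ℝ y).hasFDerivAt)
  refine ext_inner_right ℝ fun v => ?_
  rw [inner_gradient_left, sub_eq_zero.1 hzero, innerSL_apply_apply]

end SupportFunction

section Polar

variable {n : ℕ} {K : Set (E n)}

theorem mem_polarBody_iff (hK : IsCompact K) (hne : K.Nonempty) {x : E n} :
    x ∈ polarBody K ↔ supp K x ≤ 1 := by
  refine ⟨fun hx => ?_, fun hx y hy => (inner_le_supp hK x hy).trans hx⟩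
  obtain ⟨y, hy, hxy⟩ := exists_inner_eq_supp hK hne x
  exact hxy ▸ hx y hy

theorem isClosed_polarBody (K : Set (E n)) : IsClosed (polarBody K) := by
  simp only [polarBody, ofPred_forall]
  exact isClosed_biInter fun y _ => isClosed_le (by fun_prop) continuous_const

theorem convex_polarBody (K : Set (E n)) : Convex ℝ (polarBody K) := by
  simp only [polarBody, ofPred_forall, ← real_inner_comm]
  exact convex_iInter₂ fun y _ => convex_halfSpace_le (innerₛₗ ℝ y).isLinear 1

theorem isCompact_polarBody (h0 : 0 ∈ interior K) : IsCompact (polarBody K) := by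
  obtain ⟨r, hr, hrK⟩ := Metric.nhds_basis_closedBall.mem_iff.1 (mem_interior_iff_mem_nhds.1 h0)
  refine Metric.isCompact_of_isClosed_isBounded (isClosed_polarBody K)
    ((Metric.isBounded_closedBall (x := (0 : E n)) (r := r⁻¹)).subset fun x hx => ?_)
  rw [mem_closedBall_zero_iff]
  rcases eq_or_ne x 0 with rfl | hx0
  · simp only [norm_zero, inv_nonneg, hr.le]
  have hn : 0 < ‖x‖ := norm_pos_iff.2 hx0
  have hxr := hx ((r * ‖x‖⁻¹) • x) (hrK (by
    rw [mem_closedBall_zero_iff, norm_smul, Real.norm_of_nonneg (by positivity),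
      inv_mul_cancel_right₀ hn.ne']))
  rw [real_inner_smul_right, real_inner_self_eq_norm_sq] at hxr
  rw [← one_div, le_div_iff₀ hr]
  calc ‖x‖ * r = r * ‖x‖⁻¹ * ‖x‖ ^ 2 := by field_simp
    _ ≤ 1 := hxr

theorem zero_mem_interior_polarBody (hK : IsCompact K) : 0 ∈ interior (polarBody K) := by
  obtain ⟨R, hR, hKR⟩ := hK.isBounded.exists_pos_norm_le
  rw [mem_interior_iff_mem_nhds]
  filter_upwards [Metric.ball_mem_nhds 0 (inv_pos.2 hR)] with x hx y hy
  rw [mem_ball_zero_iff] at hx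
  calc ⟪x, y⟫ ≤ ‖x‖ * ‖y‖ := real_inner_le_norm x y
    _ ≤ R⁻¹ * R := by gcongr; exact hKR y hy
    _ = 1 := inv_mul_cancel₀ hR.ne'

end Polar

section Hessian

variable {n : ℕ} {K : Set (E n)} {x : E n}

/-- Compact sets with the origin in the interior and with a support function that is smooth away
from the origin. Only the convex hull of `K` matters for this, so convexity is not asked for. -/
structure IsSmoothlySupported (K : Set (E n)) : Prop where
  isCompact : IsCompact K
  zero_mem_interior : 0 ∈ interior K
  contDiffOn_supp : ContDiffOn ℝ ∞ (supp K) {0}ᶜ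

namespace IsSmoothlySupported

theorem nonempty (hK : IsSmoothlySupported K) : K.Nonempty :=
  ⟨0, interior_subset hK.zero_mem_interior⟩

theorem supp_pos (hK : IsSmoothlySupported K) (hx : x ≠ 0) : 0 < supp K x :=
  GaussFlow.supp_pos hK.isCompact hK.zero_mem_interior hx

theorem contDiffAt_supp (hK : IsSmoothlySupported K) (hx : x ≠ 0) : ContDiffAt ℝ ∞ (supp K) x :=
  hK.contDiffOn_supp.contDiffAt (isOpen_compl_singleton.mem_nhds hx)

theorem differentiableAt_supp (hK : IsSmoothlySupported K) (hx : x ≠ 0) :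
    DifferentiableAt ℝ (supp K) x :=
  (hK.contDiffAt_supp hx).differentiableAt (by simp)

theorem contDiffAt_gradient_supp (hK : IsSmoothlySupported K) (hx : x ≠ 0) :
    ContDiffAt ℝ ∞ (gradient (supp K)) x :=
  contDiffAt_gradient (hK.contDiffAt_supp hx) (by norm_cast)

theorem hasFDerivAt_gradient_supp (hK : IsSmoothlySupported K) (hx : x ≠ 0) :
    HasFDerivAt (gradient (supp K)) (fderiv ℝ (gradient (supp K)) x) x :=
  ((hK.contDiffAt_gradient_supp hx).differentiableAt (by simp)).hasFDerivAt

theorem gradient_supp_mem (hK : IsSmoothlySupported K) (hx : x ≠ 0) :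
    gradient (supp K) x ∈ K := by
  obtain ⟨y, hy, hxy⟩ := exists_inner_eq_supp hK.isCompact hK.nonempty x
  rwa [gradient_supp_eq hK.isCompact hy hxy (hK.differentiableAt_supp hx)]

theorem inner_gradient_supp (hK : IsSmoothlySupported K) (hx : x ≠ 0) :
    ⟪x, gradient (supp K) x⟫ = supp K x := by
  rw [real_inner_comm, (posHomogeneous_supp K).inner_gradient_self (hK.differentiableAt_supp hx),
    Nat.cast_one, one_mul]

theorem fderiv_supp_self (hK : IsSmoothlySupported K) (hx : x ≠ 0) :
    fderiv ℝ (supp K) x x = supp K x := by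
  rw [← inner_gradient_left, real_inner_comm, hK.inner_gradient_supp hx]

theorem isMaxOn_gradient_supp (hK : IsSmoothlySupported K) (hx : x ≠ 0) :
    IsMaxOn (fun k => ⟪x, k⟫) K (gradient (supp K) x) :=
  isMaxOn_inner_of_eq_supp hK.isCompact (hK.inner_gradient_supp hx)

theorem inner_fderiv_gradient_supp_nonneg (hK : IsSmoothlySupported K) (hx : x ≠ 0) (v : E n) :
    0 ≤ ⟪fderiv ℝ (gradient (supp K)) x v, v⟫ := by
  refine inner_apply_self_nonneg_of_monotone (hK.hasFDerivAt_gradient_supp hx) ?_ v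
  filter_upwards [isOpen_compl_singleton.mem_nhds hx] with y hy
  have hxy := hK.isMaxOn_gradient_supp hx (hK.gradient_supp_mem hy)
  have hyx := hK.isMaxOn_gradient_supp hy (hK.gradient_supp_mem hx)
  rw [real_inner_comm, inner_sub_left, inner_sub_right, inner_sub_right]
  simp only [mem_ofPred_eq] at hxy hyx
  linarith

theorem mem_span_of_fderiv_gradient_supp_eq_zero (hK : IsSmoothlySupported K)
    (hb : HasSmoothBoundary K) (hx : x ≠ 0) {v : E n}
    (hv : fderiv ℝ (gradient (supp K)) x v = 0) : v ∈ ℝ ∙ x := by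
  obtain ⟨N, hN, hN0, hray⟩ := hb.exists_normalField
    (mem_frontier_of_isMaxOn_inner hx (hK.gradient_supp_mem hx) (hK.isMaxOn_gradient_supp hx))
  refine mem_span_singleton_of_eventually_sameRay
    (hN.hasFDerivAt.comp x (hK.hasFDerivAt_gradient_supp hx)) hx hN0 ?_ (by
      rw [ContinuousLinearMap.comp_apply, hv, map_zero])
  filter_upwards [isOpen_compl_singleton.mem_nhds hx,
    (hK.contDiffAt_gradient_supp hx).continuousAt.eventually hray] with y hy hrayy
  exact hrayy (hK.gradient_supp_mem hy) y (hK.isMaxOn_gradient_supp hy)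

theorem inner_fderiv_gradient_supp_pos (hK : IsSmoothlySupported K) (hb : HasSmoothBoundary K)
    (hx : x ≠ 0) {v : E n} (hv : v ∉ ℝ ∙ x) :
    0 < ⟪fderiv ℝ (gradient (supp K)) x v, v⟫ := by
  refine (hK.inner_fderiv_gradient_supp_nonneg hx v).lt_of_ne' fun hzero => hv ?_
  let B : LinearMap.BilinForm ℝ (E n) :=
    (innerₗ (E n)).comp (fderiv ℝ (gradient (supp K)) x : E n →ₗ[ℝ] E n)
  have hsymm : LinearMap.IsSymm B := ⟨fun u w =>
    inner_fderiv_gradient_comm ((hK.contDiffAt_supp hx).of_le (by norm_cast)) u w⟩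
  have hker := (LinearMap.BilinForm.apply_apply_same_eq_zero_iff B
    (hK.inner_fderiv_gradient_supp_nonneg hx) hsymm).1 hzero
  exact hK.mem_span_of_fderiv_gradient_supp_eq_zero hb hx
    (inner_self_eq_zero.1 (congrArg (fun L : E n →ₗ[ℝ] ℝ => L _) (LinearMap.mem_ker.1 hker)))

theorem inner_fderiv_gradient_supp_pos_of_fderiv_supp_eq_zero (hK : IsSmoothlySupported K)
    (hb : HasSmoothBoundary K) (hx : x ≠ 0) {v : E n} (hv : v ≠ 0)
    (hdv : fderiv ℝ (supp K) x v = 0) : 0 < ⟪fderiv ℝ (gradient (supp K)) x v, v⟫ := by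
  refine hK.inner_fderiv_gradient_supp_pos hb hx fun hmem => hv ?_
  obtain ⟨c, rfl⟩ := Submodule.mem_span_singleton.1 hmem
  rw [map_smul, hK.fderiv_supp_self hx, smul_eq_mul] at hdv
  rw [(mul_eq_zero.1 hdv).resolve_right (hK.supp_pos hx).ne', zero_smul]

theorem isSmoothStrictlyConvexBody_polarBody (hK : IsSmoothlySupported K)
    (hb : HasSmoothBoundary K) : IsSmoothStrictlyConvexBody (polarBody K) where
  isCompact := isCompact_polarBody hK.zero_mem_interior
  convex := convex_polarBody K
  nonempty_interior := ⟨0, zero_mem_interior_polarBody hK.isCompact⟩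
  smooth_boundary := by
    intro x hx
    have hx0 : x ≠ 0 := fun h => hx.2 (h ▸ zero_mem_interior_polarBody hK.isCompact)
    have hfderiv : fderiv ℝ (fun y => supp K y - 1) = fderiv ℝ (supp K) :=
      funext fun y => fderiv_sub_const 1
    refine ⟨{0}ᶜ, fun y => supp K y - 1, isOpen_compl_singleton, hx0,
      hK.contDiffOn_supp.sub contDiffOn_const, ?_, ?_, fun v hv hdv => ?_⟩
    · ext y
      simp only [mem_inter_iff, mem_polarBody_iff hK.isCompact hK.nonempty, mem_ofPred_eq,
        sub_nonpos, and_comm]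
    · intro hzero
      have hself := hK.fderiv_supp_self hx0
      rw [← hfderiv, hzero] at hself
      exact (hK.supp_pos hx0).ne hself
    · rw [hfderiv] at hdv ⊢
      rw [← inner_fderiv_gradient ((hK.contDiffAt_supp hx0).of_le (by norm_cast))]
      exact hK.inner_fderiv_gradient_supp_pos_of_fderiv_supp_eq_zero hb hx0 hv hdv

end IsSmoothlySupported

end Hessian

section Duality

variable {n : ℕ} {K : Set (E n)} {x z : E n}

/-- The gradient `s ∇s` of half the squared support function `s` of `K`. It is inverse to the
duality map of the polar body and carries the outer normals of the polar body to those of `K`. -/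
def dualityMap (K : Set (E n)) (x : E n) : E n :=
  supp K x • gradient (supp K) x

theorem posHomogeneous_dualityMap (K : Set (E n)) : PosHomogeneous 1 (dualityMap K) := by
  intro c hc x
  rw [dualityMap, dualityMap, posHomogeneous_supp K hc, posHomogeneous_gradient
    (posHomogeneous_supp K) hc, pow_zero, one_smul, smul_assoc]

namespace IsSmoothlySupported

theorem contDiffAt_dualityMap (hK : IsSmoothlySupported K) (hx : x ≠ 0) :
    ContDiffAt ℝ ∞ (dualityMap K) x :=
  (hK.contDiffAt_supp hx).smul (hK.contDiffAt_gradient_supp hx)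

theorem hasFDerivAt_dualityMap (hK : IsSmoothlySupported K) (hx : x ≠ 0) :
    HasFDerivAt (dualityMap K) (fderiv ℝ (dualityMap K) x) x :=
  ((hK.contDiffAt_dualityMap hx).differentiableAt (by simp)).hasFDerivAt

theorem inner_fderiv_dualityMap (hK : IsSmoothlySupported K) (hx : x ≠ 0) (v : E n) :
    ⟪fderiv ℝ (dualityMap K) x v, v⟫ =
      supp K x * ⟪fderiv ℝ (gradient (supp K)) x v, v⟫ + fderiv ℝ (supp K) x v ^ 2 := by
  have hderiv : HasFDerivAt (dualityMap K) _ x :=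
    (hK.differentiableAt_supp hx).hasFDerivAt.smul (hK.hasFDerivAt_gradient_supp hx)
  simp only [hderiv.fderiv, add_apply, smul_apply, ContinuousLinearMap.smulRight_apply,
    inner_add_left, real_inner_smul_left, inner_gradient_left, sq]

theorem inner_fderiv_dualityMap_pos (hK : IsSmoothlySupported K) (hb : HasSmoothBoundary K)
    (hx : x ≠ 0) {v : E n} (hv : v ≠ 0) : 0 < ⟪fderiv ℝ (dualityMap K) x v, v⟫ := by
  rw [hK.inner_fderiv_dualityMap hx]
  have hs := hK.supp_pos hx
  rcases eq_or_ne (fderiv ℝ (supp K) x v) 0 with hdv | hdv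
  · have := hK.inner_fderiv_gradient_supp_pos_of_fderiv_supp_eq_zero hb hx hv hdv
    positivity
  · have := hK.inner_fderiv_gradient_supp_nonneg hx v
    positivity

theorem injective_fderiv_dualityMap (hK : IsSmoothlySupported K) (hb : HasSmoothBoundary K)
    (hx : x ≠ 0) : Function.Injective (fderiv ℝ (dualityMap K) x) := by
  refine (injective_iff_map_eq_zero _).2 fun v hv => ?_
  by_contra hv0
  exact (hK.inner_fderiv_dualityMap_pos hb hx hv0).ne' (by rw [hv, inner_zero_left])

theorem inner_dualityMap_self (hK : IsSmoothlySupported K) (hx : x ≠ 0) :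
    ⟪dualityMap K x, x⟫ = supp K x ^ 2 := by
  rw [dualityMap, real_inner_smul_left, real_inner_comm, hK.inner_gradient_supp hx, sq]

theorem dualityMap_ne_zero (hK : IsSmoothlySupported K) (hx : x ≠ 0) : dualityMap K x ≠ 0 := by
  intro hzero
  have hself := hK.inner_dualityMap_self hx
  rw [hzero, inner_zero_left] at hself
  exact (pow_pos (hK.supp_pos hx) 2).ne hself

theorem inv_supp_smul_mem_polarBody (hK : IsSmoothlySupported K) (hx : x ≠ 0) :
    (supp K x)⁻¹ • x ∈ polarBody K := by
  have hpos := hK.supp_pos hx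
  rw [mem_polarBody_iff hK.isCompact hK.nonempty, posHomogeneous_supp K (inv_pos.2 hpos), pow_one,
    smul_eq_mul, inv_mul_cancel₀ hpos.ne']

theorem inner_div_supp_le_supp_polarBody (hK : IsSmoothlySupported K) (hx : x ≠ 0) (z : E n) :
    ⟪z, x⟫ / supp K x ≤ supp (polarBody K) z := by
  have hle := inner_le_supp (isCompact_polarBody hK.zero_mem_interior) z
    (hK.inv_supp_smul_mem_polarBody hx)
  rwa [real_inner_smul_right, inv_mul_eq_div] at hle

theorem supp_polarBody_dualityMap (hK : IsSmoothlySupported K) (hx : x ≠ 0) :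
    supp (polarBody K) (dualityMap K x) = supp K x := by
  have hpos := hK.supp_pos hx
  apply le_antisymm
  · obtain ⟨w, hw, hzw⟩ := exists_inner_eq_supp (isCompact_polarBody hK.zero_mem_interior)
      ⟨0, interior_subset (zero_mem_interior_polarBody hK.isCompact)⟩ (dualityMap K x)
    rw [← hzw, dualityMap, real_inner_smul_left, real_inner_comm]
    exact mul_le_of_le_one_right hpos.le (hw _ (hK.gradient_supp_mem hx))
  · have hle := hK.inner_div_supp_le_supp_polarBody hx (dualityMap K x)
    rwa [hK.inner_dualityMap_self hx, sq, mul_div_cancel_right₀ _ hpos.ne'] at hle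

theorem gradient_supp_polarBody_dualityMap (hK : IsSmoothlySupported K) (hx : x ≠ 0)
    (hd : DifferentiableAt ℝ (supp (polarBody K)) (dualityMap K x)) :
    gradient (supp (polarBody K)) (dualityMap K x) = (supp K x)⁻¹ • x := by
  refine gradient_supp_eq (isCompact_polarBody hK.zero_mem_interior)
    (hK.inv_supp_smul_mem_polarBody hx) ?_ hd
  rw [hK.supp_polarBody_dualityMap hx, real_inner_smul_right, hK.inner_dualityMap_self hx, sq,
    inv_mul_cancel_left₀ (hK.supp_pos hx).ne']

theorem dualityMap_polarBody_dualityMap (hK : IsSmoothlySupported K) (hx : x ≠ 0)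
    (hd : DifferentiableAt ℝ (supp (polarBody K)) (dualityMap K x)) :
    dualityMap (polarBody K) (dualityMap K x) = x := by
  rw [dualityMap, hK.supp_polarBody_dualityMap hx, hK.gradient_supp_polarBody_dualityMap hx hd,
    smul_inv_smul₀ (hK.supp_pos hx).ne']

theorem injOn_dualityMap (hK : IsSmoothlySupported K) (hb : HasSmoothBoundary K) :
    InjOn (dualityMap K) {0}ᶜ := by
  intro x hx x' hx' heq
  have hpos := hK.supp_pos hx
  have hsupp : supp K x = supp K x' := by
    rw [← hK.supp_polarBody_dualityMap hx, heq, hK.supp_polarBody_dualityMap hx']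
  have hgrad : gradient (supp K) x = gradient (supp K) x' := by
    rw [dualityMap, dualityMap, ← hsupp] at heq
    exact smul_right_injective _ hpos.ne' heq
  obtain ⟨c, hc, rfl⟩ := (hb.sameRay_of_isMaxOn hx (hK.gradient_supp_mem hx)
    (hK.isMaxOn_gradient_supp hx) (hgrad ▸ hK.isMaxOn_gradient_supp hx')).exists_pos_left hx hx'
  rw [posHomogeneous_supp K hc, pow_one, smul_eq_mul, eq_comm, mul_eq_right₀ hpos.ne'] at hsupp
  rw [hsupp, one_smul]

theorem exists_dualityMap_eq (hK : IsSmoothlySupported K) (hz : z ≠ 0) :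
    ∃ y, y ≠ 0 ∧ dualityMap K y = z := by
  have hcomp := isCompact_polarBody hK.zero_mem_interior
  have hint := zero_mem_interior_polarBody hK.isCompact
  obtain ⟨w, hw, hzw⟩ := exists_inner_eq_supp hcomp ⟨0, interior_subset hint⟩ z
  have hw0 : w ≠ 0 := by
    rintro rfl
    exact (GaussFlow.supp_pos hcomp hint hz).ne (hzw ▸ (inner_zero_right z).symm)
  have hray : SameRay ℝ z (gradient (supp K) w) := by
    refine sameRay_of_isLocalMaxOn_sublevel (f := fun k => ⟪z, k⟫)
      (innerSL ℝ z).hasFDerivAt (hK.differentiableAt_supp hw0).hasGradientAt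
      (IsMaxOn.localize fun k hk => isMaxOn_inner_of_eq_supp hcomp hzw ?_)
    rw [mem_polarBody_iff hK.isCompact hK.nonempty] at hw ⊢
    exact le_trans hk hw
  have hgrad : gradient (supp K) w ≠ 0 := fun h => hK.dualityMap_ne_zero hw0 (by
    rw [dualityMap, h, smul_zero])
  obtain ⟨c, hc, hcz⟩ := hray.exists_pos_right hz hgrad
  have hpos := hK.supp_pos hw0
  refine ⟨(c / supp K w) • w, smul_ne_zero (div_pos hc hpos).ne' hw0, ?_⟩
  rw [posHomogeneous_dualityMap K (div_pos hc hpos), dualityMap, pow_one, smul_smul,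
    div_mul_cancel₀ _ hpos.ne', hcz]

theorem dualityMap_dualityMap_polarBody (hK : IsSmoothlySupported K)
    (hK' : IsSmoothlySupported (polarBody K)) (hz : z ≠ 0) :
    dualityMap K (dualityMap (polarBody K) z) = z := by
  obtain ⟨x, hx, rfl⟩ := hK.exists_dualityMap_eq hz
  rw [hK.dualityMap_polarBody_dualityMap hx (hK'.differentiableAt_supp hz)]

theorem supp_dualityMap_polarBody (hK : IsSmoothlySupported K)
    (hK' : IsSmoothlySupported (polarBody K)) (hz : z ≠ 0) :
    supp K (dualityMap (polarBody K) z) = supp (polarBody K) z := by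
  rw [← hK.supp_polarBody_dualityMap (hK'.dualityMap_ne_zero hz),
    hK.dualityMap_dualityMap_polarBody hK' hz]

theorem inner_dualityMap_polarBody_div_supp (hK : IsSmoothlySupported K)
    (hK' : IsSmoothlySupported (polarBody K)) (hz : z ≠ 0) :
    ⟪z, dualityMap (polarBody K) z⟫ / supp K (dualityMap (polarBody K) z) =
      supp (polarBody K) z := by
  rw [hK.supp_dualityMap_polarBody hK' hz, real_inner_comm, hK'.inner_dualityMap_self hz, sq,
    mul_self_div_self]

theorem det_fderiv_dualityMap_mul (hK : IsSmoothlySupported K)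
    (hK' : IsSmoothlySupported (polarBody K)) (hx : x ≠ 0) :
    LinearMap.det (fderiv ℝ (dualityMap (polarBody K)) (dualityMap K x) : E n →ₗ[ℝ] E n) *
      LinearMap.det (fderiv ℝ (dualityMap K) x : E n →ₗ[ℝ] E n) = 1 := by
  have hinv : dualityMap (polarBody K) ∘ dualityMap K =ᶠ[𝓝 x] id := by
    filter_upwards [isOpen_compl_singleton.mem_nhds hx] with y hy
    exact hK.dualityMap_polarBody_dualityMap hy
      (hK'.differentiableAt_supp (hK.dualityMap_ne_zero hy))
  have hcomp := (hK'.hasFDerivAt_dualityMap (hK.dualityMap_ne_zero hx)).comp x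
    (hK.hasFDerivAt_dualityMap hx)
  rw [← LinearMap.det_comp, ← ContinuousLinearMap.toLinearMap_comp,
    hcomp.unique ((hasFDerivAt_id x).congr_of_eventuallyEq hinv)]
  exact LinearMap.det_id

end IsSmoothlySupported

end Duality

section FiberwiseInverse

variable {V W P : Type*} [NormedAddCommGroup V] [NormedSpace ℝ V] [NormedAddCommGroup W]
  [NormedSpace ℝ W] [NormedAddCommGroup P] [NormedSpace ℝ P]

theorem contDiffOn_of_rightInvOn [CompleteSpace V] {S : Set V} {S' : Set W} {k : ℕ∞}
    (hS : UniqueDiffOn ℝ S) (hS' : UniqueDiffOn ℝ S') {f : V → W} {g : W → V}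
    (hf : ContDiffOn ℝ k f S) (hg : ContinuousOn g S') (hmaps : MapsTo g S' S)
    (hinv : RightInvOn g f S') (hiso : ∀ x ∈ S, (fderivWithin ℝ f S x).IsInvertible) :
    ContDiffOn ℝ k g S' := by
  have hderiv (hk : (1 : WithTop ℕ∞) ≤ k) :
      ∀ y ∈ S', HasFDerivWithinAt g (fderivWithin ℝ f S (g y)).inverse S' y := by
    intro y hy
    obtain ⟨e, he⟩ := hiso (g y) (hmaps hy)
    have hfe : HasFDerivWithinAt f (e : V →L[ℝ] W) S (g y) := by
      rw [he]
      exact (hf.differentiableOn (zero_lt_one.trans_le hk).ne' _ (hmaps hy)).hasFDerivWithinAt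
    rw [← he, ContinuousLinearMap.inverse_equiv]
    exact hfe.of_local_left_inverse ((hg y hy).tendsto_nhdsWithin hmaps) hy
      (eventually_mem_nhdsWithin.mono fun x hx => hinv hx)
  refine contDiffOn_iff_forall_nat_le.2 fun m hm => ?_
  induction m with
  | zero => exact contDiffOn_zero.2 hg
  | succ m ih =>
    have hmk : (m + 1 : WithTop ℕ∞) ≤ k := by exact_mod_cast hm
    have hderiv' := hderiv (le_add_self.trans hmk)
    rw [Nat.cast_add_one]
    refine contDiffOn_succ_of_fderivWithin (fun y hy => (hderiv' y hy).differentiableWithinAt)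
      (by simp) (ContDiffOn.congr (f := fun y => (fderivWithin ℝ f S (g y)).inverse)
        (fun y hy => ?_) fun y hy => (hderiv' y hy).fderivWithin (hS' y hy))
    exact (hiso _ (hmaps hy)).contDiffAt_map_inverse.comp_contDiffWithinAt y
      (((hf.fderivWithin hS hmk).comp (ih ((Nat.cast_le.2 m.le_succ).trans hm)) hmaps) y hy)

theorem hasFDerivAt_prodMk_right {f : V × P → W} {f' : V × P →L[ℝ] W} {A : Set V} {I : Set P}
    {x : V} {t : P} (hf : HasFDerivWithinAt f f' (A ×ˢ I) (x, t)) (hA : A ∈ 𝓝 x) (ht : t ∈ I) :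
    HasFDerivAt (fun y => f (y, t)) (f'.comp (.inl ℝ V P)) x :=
  (HasFDerivWithinAt.comp x (t := A ×ˢ I) hf (hasFDerivAt_prodMk_left x t).hasFDerivWithinAt
    fun _ hy => ⟨hy, ht⟩).hasFDerivAt hA

theorem contDiffOn_of_fiberwise_rightInverse [FiniteDimensional ℝ V] [FiniteDimensional ℝ P]
    {A B : Set V} {I : Set P} (hA : IsOpen A) (hB : IsOpen B) (hI : UniqueDiffOn ℝ I)
    {f g : V × P → V} (hf : ContDiffOn ℝ ∞ f (A ×ˢ I)) (hg : ContinuousOn g (B ×ˢ I))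
    (hmaps : MapsTo g (B ×ˢ I) A) (hinv : ∀ p ∈ B ×ˢ I, f (g p, p.2) = p.1)
    (hinj : ∀ p ∈ A ×ˢ I, Function.Injective (fderiv ℝ (fun y => f (y, p.2)) p.1)) :
    ContDiffOn ℝ ∞ g (B ×ˢ I) := by
  have hAI : UniqueDiffOn ℝ (A ×ˢ I) := hA.uniqueDiffOn.prod hI
  refine contDiff_fst.comp_contDiffOn (contDiffOn_of_rightInvOn (k := ⊤)
    (f := fun p => (f p, p.2)) (g := fun p => (g p, p.2)) hAI (hB.uniqueDiffOn.prod hI)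
    (hf.prodMk contDiffOn_snd) (hg.prodMk continuousOn_snd) (fun p hp => ⟨hmaps hp, hp.2⟩)
    (fun p hp => Prod.ext (hinv p hp) rfl) fun p hp => ?_)
  have hfp := (hf.differentiableOn (by simp) p hp).hasFDerivWithinAt
  rw [(hfp.prodMk hasFDerivWithinAt_snd).fderivWithin (hAI p hp)]
  have hker : Function.Injective
      ((fderivWithin ℝ f (A ×ˢ I) p).prod (.snd ℝ V P) : V × P →L[ℝ] V × P) := by
    refine (injective_iff_map_eq_zero _).2 ?_
    rintro ⟨v, τ⟩ hzero
    obtain ⟨hv, rfl : τ = 0⟩ := Prod.mk_eq_zero.1 hzero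
    have hslice := (hasFDerivAt_prodMk_right hfp (hA.mem_nhds hp.1) hp.2).fderiv
    rw [(injective_iff_map_eq_zero _).1 (hinj p hp) v (by rw [hslice]; exact hv)]
    rfl
  exact ⟨(LinearEquiv.ofInjectiveEndo _ hker).toContinuousLinearEquiv, rfl⟩

theorem tendsto_of_tendsto_direction {X Y : Type*} [TopologicalSpace X] {I : Set X}
    {f : V × X → W} (hf : ContinuousOn f ({0}ᶜ ×ˢ I))
    (hhom : ∀ t ∈ I, PosHomogeneous 1 fun x => f (x, t)) {l : Filter Y} {w : Y → V} {τ : Y → X}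
    {x : V} {t : X} {z : W} (hx : x ≠ 0) (ht : t ∈ I) (hfx : f (x, t) ≠ 0)
    (hw : ∀ᶠ q in l, w q ≠ 0) (hτ : Tendsto τ l (𝓝[I] t))
    (hdir : Tendsto (fun q => ‖w q‖⁻¹ • w q) l (𝓝 x))
    (hfw : Tendsto (fun q => f (w q, τ q)) l (𝓝 z)) (hz : z ≠ 0) :
    Tendsto w l (𝓝 ((‖z‖ / ‖f (x, t)‖) • x)) := by
  have hτI := hτ.eventually_mem self_mem_nhdsWithin
  have hfdir : Tendsto (fun q => f (‖w q‖⁻¹ • w q, τ q)) l (𝓝 (f (x, t))) :=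
    (hf (x, t) ⟨hx, ht⟩).tendsto.comp (tendsto_nhdsWithin_iff.2
      ⟨hdir.prodMk_nhds (hτ.mono_right nhdsWithin_le_nhds), hw.and hτI |>.mono fun q hq =>
        ⟨smul_ne_zero (inv_ne_zero (norm_ne_zero_iff.2 hq.1)) hq.1, hq.2⟩⟩)
  have hnorm : Tendsto (fun q => ‖w q‖) l (𝓝 (‖z‖ / ‖f (x, t)‖)) := by
    refine Tendsto.congr' ?_ (hfw.norm.div hfdir.norm (norm_ne_zero_iff.2 hfx))
    filter_upwards [hw, hτI, hfw.eventually_ne hz] with q hwq hτq hfq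
    have hhomq : f (‖w q‖⁻¹ • w q, τ q) = ‖w q‖⁻¹ ^ 1 • f (w q, τ q) :=
      hhom (τ q) hτq (inv_pos.2 (norm_pos_iff.2 hwq)) (w q)
    rw [Pi.div_apply, hhomq, pow_one, norm_smul, norm_inv, norm_norm, inv_mul_eq_div,
      div_div_cancel₀ (norm_ne_zero_iff.2 hfq)]
  exact (hnorm.smul hdir).congr' (hw.mono fun q hq => smul_inv_smul₀ (norm_ne_zero_iff.2 hq) _)

theorem continuousOn_of_posHomogeneous_rightInverse [FiniteDimensional ℝ V] {X : Type*}
    [TopologicalSpace X] {I : Set X} {f : V × X → W} {g : W × X → V}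
    (hf : ContinuousOn f ({0}ᶜ ×ˢ I)) (hhom : ∀ t ∈ I, PosHomogeneous 1 fun x => f (x, t))
    (hf0 : ∀ p ∈ ({0}ᶜ : Set V) ×ˢ I, f p ≠ 0) (hinj : ∀ t ∈ I, InjOn (fun x => f (x, t)) {0}ᶜ)
    (hmaps : MapsTo g ({0}ᶜ ×ˢ I) {0}ᶜ) (hinv : ∀ p ∈ ({0}ᶜ : Set W) ×ˢ I, f (g p, p.2) = p.1) :
    ContinuousOn g ({0}ᶜ ×ˢ I) := by
  rintro ⟨z, t⟩ hzt
  refine (tendsto_iff_ultrafilter _ _ _).2 fun u hu => ?_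
  have hmem : ∀ᶠ q in (u : Filter (W × X)), q ∈ ({0}ᶜ : Set W) ×ˢ I := hu self_mem_nhdsWithin
  have hg0 : ∀ᶠ q in (u : Filter (W × X)), g q ≠ 0 := hmem.mono fun q hq => hmaps hq
  have hsnd : Tendsto Prod.snd (u : Filter (W × X)) (𝓝[I] t) :=
    (tendsto_snd.mono_left (nhdsWithin_prod_eq z t {0}ᶜ I).le).mono_left hu
  have hfg : Tendsto (fun q => f (g q, q.2)) (u : Filter (W × X)) (𝓝 z) :=
    ((continuous_fst.tendsto (z, t)).mono_left (hu.trans nhdsWithin_le_nhds)).congr'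
      (hmem.mono fun q hq => (hinv q hq).symm)
  -- The directions of `g` converge along `u` by compactness of the sphere, homogeneity then
  -- determines the lengths, and injectivity identifies the limit.
  obtain ⟨x, hx, hdir⟩ := (isCompact_sphere (0 : V) 1).ultrafilter_le_nhds'
    (u.map fun q => ‖g q‖⁻¹ • g q)
    (hg0.mono fun q hq => mem_sphere_zero_iff_norm.2 (norm_smul_inv_norm (𝕜 := ℝ) hq))
  have hx0 : x ≠ 0 := Metric.ne_of_mem_sphere hx one_ne_zero
  have hfx : f (x, t) ≠ 0 := hf0 (x, t) ⟨hx0, hzt.2⟩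
  have hlim := tendsto_of_tendsto_direction hf hhom hx0 hzt.2 hfx hg0 hsnd hdir hfg hzt.1
  have hy0 : (‖z‖ / ‖f (x, t)‖) • x ≠ 0 :=
    smul_ne_zero (div_ne_zero (norm_ne_zero_iff.2 hzt.1) (norm_ne_zero_iff.2 hfx)) hx0
  have hfy : f ((‖z‖ / ‖f (x, t)‖) • x, t) = z := by
    refine tendsto_nhds_unique ((hf (_, t) ⟨hy0, hzt.2⟩).tendsto.comp (tendsto_nhdsWithin_iff.2
      ⟨hlim.prodMk_nhds (hsnd.mono_right nhdsWithin_le_nhds), ?_⟩)) hfg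
    filter_upwards [hmem] with q hq using ⟨hmaps hq, hq.2⟩
  rwa [hinj t hzt.2 (hmaps hzt) hy0 ((hinv _ hzt).trans hfy.symm)]

end FiberwiseInverse

section Family

theorem contDiffOn_gradient_prodMk_right {V P : Type*} [NormedAddCommGroup V]
    [InnerProductSpace ℝ V] [CompleteSpace V] [NormedAddCommGroup P] [NormedSpace ℝ P]
    {A : Set V} {I : Set P} {f : V × P → ℝ} (hA : IsOpen A) (hI : UniqueDiffOn ℝ I)
    (hf : ContDiffOn ℝ ∞ f (A ×ˢ I)) :
    ContDiffOn ℝ ∞ (fun p : V × P => gradient (fun y => f (y, p.2)) p.1) (A ×ˢ I) := by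
  have hfderiv := hf.fderivWithin (hA.uniqueDiffOn.prod hI) (m := ∞) (by norm_cast)
  refine ((InnerProductSpace.toDual ℝ V).symm.contDiff.comp_contDiffOn
    (hfderiv.clm_comp (contDiffOn_const (c := .inl ℝ V P)))).congr fun p hp => ?_
  have hslice := hasFDerivAt_prodMk_right (hf.differentiableOn (by simp) p hp).hasFDerivWithinAt
    (hA.mem_nhds hp.1) hp.2
  rw [gradient, hslice.fderiv, Function.comp_apply]

variable {n : ℕ} {P : Type*} [NormedAddCommGroup P] [NormedSpace ℝ P] {I : Set P}
  {K : P → Set (E n)} {t : P}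

/-- Families of compact sets with the origin in the interiors, parametrized by a set `I`, whose
support functions are jointly smooth away from the origin, up to the boundary of `I`. -/
structure IsSmoothlySupportedFamily (I : Set P) (K : P → Set (E n)) : Prop where
  isCompact : ∀ t ∈ I, IsCompact (K t)
  zero_mem_interior : ∀ t ∈ I, 0 ∈ interior (K t)
  contDiffOn_supp : ContDiffOn ℝ ∞ (fun p : E n × P => supp (K p.2) p.1) ({0}ᶜ ×ˢ I)

namespace IsSmoothlySupportedFamily

theorem isSmoothlySupported (hK : IsSmoothlySupportedFamily I K) (ht : t ∈ I) :
    IsSmoothlySupported (K t) where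
  isCompact := hK.isCompact t ht
  zero_mem_interior := hK.zero_mem_interior t ht
  contDiffOn_supp :=
    hK.contDiffOn_supp.comp (contDiff_prodMk_left t).contDiffOn fun _ hy => ⟨hy, ht⟩

theorem contDiffOn_dualityMap (hK : IsSmoothlySupportedFamily I K) (hI : UniqueDiffOn ℝ I) :
    ContDiffOn ℝ ∞ (fun p : E n × P => dualityMap (K p.2) p.1) ({0}ᶜ ×ˢ I) :=
  hK.contDiffOn_supp.smul
    (contDiffOn_gradient_prodMk_right isOpen_compl_singleton hI hK.contDiffOn_supp)

theorem exists_contDiffOn_dualityMap_eq [FiniteDimensional ℝ P]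
    (hK : IsSmoothlySupportedFamily I K) (hb : ∀ t ∈ I, HasSmoothBoundary (K t))
    (hI : UniqueDiffOn ℝ I) :
    ∃ Y : E n × P → E n, ContDiffOn ℝ ∞ Y ({0}ᶜ ×ˢ I) ∧
      ∀ p ∈ ({0}ᶜ : Set (E n)) ×ˢ I, Y p ≠ 0 ∧ dualityMap (K p.2) (Y p) = p.1 := by
  have hex : ∀ p : E n × P, p ∈ ({0}ᶜ : Set (E n)) ×ˢ I →
      ∃ y, y ≠ 0 ∧ dualityMap (K p.2) y = p.1 := fun p hp =>
    (hK.isSmoothlySupported hp.2).exists_dualityMap_eq hp.1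
  choose! Y hY0 hY using hex
  have hsmooth := hK.contDiffOn_dualityMap hI
  have hcont : ContinuousOn Y ({0}ᶜ ×ˢ I) :=
    continuousOn_of_posHomogeneous_rightInverse hsmooth.continuousOn
      (fun t _ => posHomogeneous_dualityMap (K t))
      (fun p hp => (hK.isSmoothlySupported hp.2).dualityMap_ne_zero hp.1)
      (fun t ht => (hK.isSmoothlySupported ht).injOn_dualityMap (hb t ht)) hY0 hY
  exact ⟨Y, contDiffOn_of_fiberwise_rightInverse isOpen_compl_singleton isOpen_compl_singleton hI
    hsmooth hcont hY0 hY fun p hp => (hK.isSmoothlySupported hp.2).injective_fderiv_dualityMap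
      (hb p.2 hp.2) hp.1, fun p hp => ⟨hY0 p hp, hY p hp⟩⟩

theorem isSmoothlySupportedFamily_polarBody [FiniteDimensional ℝ P]
    (hK : IsSmoothlySupportedFamily I K) (hb : ∀ t ∈ I, HasSmoothBoundary (K t))
    (hI : UniqueDiffOn ℝ I) : IsSmoothlySupportedFamily I fun t => polarBody (K t) where
  isCompact t ht := isCompact_polarBody (hK.zero_mem_interior t ht)
  zero_mem_interior t ht := zero_mem_interior_polarBody (hK.isCompact t ht)
  contDiffOn_supp := by
    obtain ⟨Y, hYsmooth, hY⟩ := hK.exists_contDiffOn_dualityMap_eq hb hI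
    refine (hK.contDiffOn_supp.comp (hYsmooth.prodMk contDiffOn_snd)
      fun p hp => ⟨(hY p hp).1, hp.2⟩).congr fun p hp => ?_
    obtain ⟨hYp, hYz⟩ := hY p hp
    rw [Function.comp_apply, ← (hK.isSmoothlySupported hp.2).supp_polarBody_dualityMap hYp, hYz]

end IsSmoothlySupportedFamily

end Family

section Envelope

theorem hasDerivWithinAt_comp_of_isLocalMax {V : Type*} [NormedAddCommGroup V] [NormedSpace ℝ V]
    {F : V × ℝ → ℝ} {A : Set V} {I : Set ℝ} {c : ℝ → V} {t d : ℝ}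
    (hF : DifferentiableWithinAt ℝ F (A ×ˢ I) (c t, t)) (hA : A ∈ 𝓝 (c t)) (ht : t ∈ I)
    (hI : UniqueDiffWithinAt ℝ I t) (hmax : IsLocalMax (fun x => F (x, t)) (c t))
    (hd : HasDerivWithinAt (fun τ => F (c t, τ)) d I t) (hc : DifferentiableWithinAt ℝ c I t)
    (hcA : MapsTo c I A) : HasDerivWithinAt (fun τ => F (c τ, τ)) d I t := by
  obtain ⟨L, hL⟩ := hF
  have hspace (v : V) : L (v, 0) = 0 :=
    congrArg (fun M : V →L[ℝ] ℝ => M v) (hmax.hasFDerivAt_eq_zero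
      (hasFDerivAt_prodMk_right hL hA ht))
  have htime : L (0, 1) = d := by
    refine hI.eq_deriv _ ?_ hd
    exact hL.comp_hasDerivWithinAt t ((hasDerivWithinAt_const t I (c t)).prodMk
      (hasDerivWithinAt_id t I)) fun τ hτ => ⟨hcA ht, hτ⟩
  have hcurve : HasDerivWithinAt (fun τ => F (c τ, τ)) (L (derivWithin c I t, 1)) I t :=
    hL.comp_hasDerivWithinAt (f := fun τ => (c τ, τ)) t
      (hc.hasDerivWithinAt.prodMk (hasDerivWithinAt_id t I)) fun τ hτ => ⟨hcA hτ, hτ⟩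
  rwa [← htime, ← zero_add (L (0, 1)), ← hspace (derivWithin c I t), ← map_add, Prod.mk_add_mk,
    add_zero, zero_add]

variable {n : ℕ} {I : Set ℝ} {K : ℝ → Set (E n)} {t : ℝ} {z : E n}

theorem IsSmoothlySupportedFamily.hasDerivWithinAt_supp_polarBody
    (hK : IsSmoothlySupportedFamily I K)
    (hK' : IsSmoothlySupportedFamily I fun t => polarBody (K t))
    (hI : UniqueDiffOn ℝ I) (ht : t ∈ I) (hz : z ≠ 0) {d : ℝ}
    (hd : HasDerivWithinAt (fun τ => supp (K τ) (dualityMap (polarBody (K t)) z)) d I t) :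
    HasDerivWithinAt (fun τ => supp (polarBody (K τ)) z) (-d) I t := by
  have hL := fun τ hτ => hK.isSmoothlySupported (t := τ) hτ
  have hL' := fun τ hτ => hK'.isSmoothlySupported (t := τ) hτ
  have hcne : MapsTo (fun τ => dualityMap (polarBody (K τ)) z) I {0}ᶜ := fun τ hτ =>
    (hL' τ hτ).dualityMap_ne_zero hz
  have hpos := (hL t ht).supp_pos (hcne ht)
  have hinner := (hL t ht).inner_dualityMap_polarBody_div_supp (hL' t ht) hz
  have hF : ContDiffOn ℝ ∞ (fun p : E n × ℝ => ⟪z, p.1⟫ / supp (K p.2) p.1) ({0}ᶜ ×ˢ I) :=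
    (contDiffOn_const.inner ℝ contDiffOn_fst).div hK.contDiffOn_supp
      fun p hp => ((hL p.2 hp.2).supp_pos hp.1).ne'
  have hc : DifferentiableWithinAt ℝ (fun τ => dualityMap (polarBody (K τ)) z) I t :=
    ((hK'.contDiffOn_dualityMap hI).comp (contDiff_prodMk_right z).contDiffOn
      fun τ hτ => ⟨hz, hτ⟩).differentiableOn (by simp) t ht
  -- `supp (polarBody K) z` is the maximum over `x` of `⟪z, x⟫ / supp K x`, attained at the dual
  -- point of `z`.
  refine (hasDerivWithinAt_comp_of_isLocalMax (hF.differentiableOn (by simp) _ ⟨hcne ht, ht⟩)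
    (isOpen_compl_singleton.mem_nhds (hcne ht)) ht (hI t ht) ?_ ?_ hc hcne).congr_of_mem
    (fun τ hτ => ((hL τ hτ).inner_dualityMap_polarBody_div_supp (hL' τ hτ) hz).symm) ht
  · filter_upwards [isOpen_compl_singleton.mem_nhds (hcne ht)] with x hx
    rw [hinner]
    exact (hL t ht).inner_div_supp_le_supp_polarBody hx z
  · have hconst := hasDerivWithinAt_const t I ⟪z, dualityMap (polarBody (K t)) z⟫
    refine (hconst.fun_div hd hpos.ne').congr_deriv ?_
    rw [(hL t ht).supp_dualityMap_polarBody (hL' t ht) hz] at hinner hpos ⊢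
    rw [(div_eq_iff hpos.ne').1 hinner]
    field_simp
    ring

end Envelope

section Flow

variable {n : ℕ}

theorem supp_eq_norm_mul_radialExt (K : Set (E n)) {x : E n} (hx : x ≠ 0) :
    supp K x = ‖x‖ * radialExt (supp K) x := by
  rw [radialExt_of_posHomogeneous (posHomogeneous_supp K) hx, pow_one, smul_eq_mul,
    mul_inv_cancel_left₀ (norm_ne_zero_iff.2 hx)]

theorem contDiffOn_radialExt_supp_iff {P : Type*} [NormedAddCommGroup P] [NormedSpace ℝ P]
    {I : Set P} {K : P → Set (E n)} :
    ContDiffOn ℝ ∞ (fun p : E n × P => radialExt (supp (K p.2)) p.1) ({0}ᶜ ×ˢ I) ↔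
      ContDiffOn ℝ ∞ (fun p : E n × P => supp (K p.2) p.1) ({0}ᶜ ×ˢ I) := by
  have hnorm : ContDiffOn ℝ ∞ (fun p : E n × P => ‖p.1‖) ({0}ᶜ ×ˢ I) :=
    contDiffOn_fst.norm ℝ fun p hp => hp.1
  have hne : ∀ p ∈ ({0}ᶜ : Set (E n)) ×ˢ I, ‖p.1‖ ≠ 0 := fun p hp => norm_ne_zero_iff.2 hp.1
  refine ⟨fun h => (hnorm.mul h).congr fun p hp => supp_eq_norm_mul_radialExt _ hp.1,
    fun h => ((hnorm.inv hne).mul h).congr fun p hp => ?_⟩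
  rw [supp_eq_norm_mul_radialExt _ hp.1, Pi.inv_apply, inv_mul_cancel_left₀ (hne p hp)]

theorem IsSmoothStrictlyConvexBody.hasSmoothBoundary {K : Set (E n)}
    (hK : IsSmoothStrictlyConvexBody K) : HasSmoothBoundary K := fun x hx =>
  let ⟨U, ρ, hU, hxU, hρ, hKU, hρx, _⟩ := hK.smooth_boundary x hx
  ⟨U, ρ, hU, hxU, hρ, hKU, hρx⟩

theorem EvolvesBy.isSmoothlySupportedFamily {speed : (E n → ℝ) → E n → ℝ} {T : ℝ}
    {K : ℝ → Set (E n)} (hK : EvolvesBy speed T K) : IsSmoothlySupportedFamily (Ico 0 T) K where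
  isCompact t ht := (hK.body t ht).isCompact
  zero_mem_interior := hK.zero_mem
  contDiffOn_supp := contDiffOn_radialExt_supp_iff.1 hK.smooth

theorem EvolvesBy.hasDerivWithinAt_supp {speed : (E n → ℝ) → E n → ℝ} {T : ℝ} {K : ℝ → Set (E n)}
    (hK : EvolvesBy speed T K) {t : ℝ} (ht : t ∈ Ico 0 T) {x : E n} (hx : x ≠ 0) :
    HasDerivWithinAt (fun τ => supp (K τ) x) (‖x‖ * speed (supp (K t)) (‖x‖⁻¹ • x)) (Ico 0 T) t :=
  ((hK.evolution t ht _ (mem_sphere_zero_iff_norm.2 (norm_smul_inv_norm (𝕜 := ℝ) hx))).const_mul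
    ‖x‖).congr_of_mem (fun τ _ => supp_eq_norm_mul_radialExt (K τ) hx) ht

end Flow

namespace IsSmoothlySupported

variable {n : ℕ} {K : Set (E n)} {x z : E n}

theorem norm_dualityMap (hK : IsSmoothlySupported K) (hx : x ≠ 0) :
    ‖dualityMap K x‖ = supp K x * ‖gradient (supp K) x‖ := by
  rw [dualityMap, norm_smul, Real.norm_of_nonneg (hK.supp_pos hx).le]

theorem norm_gradient_supp (hK : IsSmoothlySupported K) (hz : ‖z‖ = 1) :
    ‖gradient (supp K) z‖ = √(supp K z ^ 2 + ‖sphGrad (supp K) z‖ ^ 2) := by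
  have hz0 : z ≠ 0 := norm_ne_zero_iff.1 (hz ▸ one_ne_zero)
  rw [sq_add_norm_sphGrad_sq (posHomogeneous_supp K) (hK.differentiableAt_supp hz0) hz,
    Real.sqrt_sq (norm_nonneg _)]

theorem det_fderiv_dualityMap (hK : IsSmoothlySupported K) (hx : x ≠ 0) :
    LinearMap.det (fderiv ℝ (dualityMap K) x : E n →ₗ[ℝ] E n) =
      (supp K x / ‖x‖) ^ (n + 1) * sigma (supp K) (‖x‖⁻¹ • x) := by
  have hnx := inv_pos.2 (norm_pos_iff.2 hx)
  have hunit : ‖‖x‖⁻¹ • x‖ = 1 := norm_smul_inv_norm (𝕜 := ℝ) hx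
  have hsupp : supp K (‖x‖⁻¹ • x) = supp K x / ‖x‖ := by
    rw [posHomogeneous_supp K hnx, pow_one, smul_eq_mul, inv_mul_eq_div]
  have hfderiv : fderiv ℝ (dualityMap K) (‖x‖⁻¹ • x) = fderiv ℝ (dualityMap K) x := by
    rw [(posHomogeneous_dualityMap K).fderiv_smul hnx, pow_zero, one_smul]
  rw [← hfderiv, ← hsupp]
  exact det_fderiv_smul_gradient (posHomogeneous_supp K) hK.contDiffOn_supp hunit
    (hK.supp_pos (smul_ne_zero hnx.ne' hx)).ne'

theorem one_div_sigma_supp_dualityMap_polarBody (hK : IsSmoothlySupported K)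
    (hK' : IsSmoothlySupported (polarBody K)) (hz : ‖z‖ = 1) :
    1 / sigma (supp K) (‖dualityMap (polarBody K) z‖⁻¹ • dualityMap (polarBody K) z) =
      (supp (polarBody K) z / ‖gradient (supp (polarBody K)) z‖) ^ (n + 1) *
        sigma (supp (polarBody K)) z := by
  have hz0 : z ≠ 0 := norm_ne_zero_iff.1 (hz ▸ one_ne_zero)
  have hs := hK'.supp_pos hz0
  have hy := hK'.dualityMap_ne_zero hz0
  have hdet := hK.det_fderiv_dualityMap_mul hK' hy
  rw [hK.dualityMap_dualityMap_polarBody hK' hz0, hK'.det_fderiv_dualityMap hz0,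
    hK.det_fderiv_dualityMap hy, hK.supp_dualityMap_polarBody hK' hz0, hK'.norm_dualityMap hz0,
    hz, div_one, inv_one, one_smul, div_mul_cancel_left₀ hs.ne'] at hdet
  rw [hK'.norm_dualityMap hz0]
  refine (eq_one_div_of_mul_eq_one_left ?_).symm
  rw [← hdet, div_eq_mul_inv, mul_pow]
  ring

end IsSmoothlySupported

theorem mul_sqrt_mul_div_sqrt_pow_mul (n : ℕ) (a b σ : ℝ) :
    a * √(a ^ 2 + b ^ 2) * ((a / √(a ^ 2 + b ^ 2)) ^ (n + 1) * σ) =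
      a ^ (n + 2) * σ / (a ^ 2 + b ^ 2) ^ ((n : ℝ) / 2) := by
  rcases eq_or_ne a 0 with rfl | ha
  · simp
  have hpos : 0 < a ^ 2 + b ^ 2 := by positivity
  have : √(a ^ 2 + b ^ 2) ≠ 0 := (Real.sqrt_pos.2 hpos).ne'
  rw [Real.rpow_div_two_eq_sqrt _ hpos.le, Real.rpow_natCast, div_pow]
  field_simp
  ring

end GaussFlow

end

/-- `1 / sigma s z` is the Gauss curvature at the boundary point with outer normal `z`, so `K` moves
inwards with a speed that is the function `ψ` of its Gauss curvature. -/
theorem mainTheorem2_general (n : ℕ) (T : ℝ) (K : ℝ → Set (GaussFlow.E n)) (ψ : ℝ → ℝ)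
    (hK : GaussFlow.EvolvesBy (fun s z => -ψ (1 / GaussFlow.sigma s z)) T K) :
    GaussFlow.EvolvesBy
      (fun s z => s z * √(s z ^ 2 + ‖GaussFlow.sphGrad s z‖ ^ 2) *
        ψ ((s z / √(s z ^ 2 + ‖GaussFlow.sphGrad s z‖ ^ 2)) ^ (n + 1) * GaussFlow.sigma s z))
      T (fun t => GaussFlow.polarBody (K t)) := by
  have hI : UniqueDiffOn ℝ (Set.Ico 0 T) := uniqueDiffOn_Ico 0 T
  have hb := fun t ht => (hK.body t ht).hasSmoothBoundary
  have hF := hK.isSmoothlySupportedFamily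
  have hF' := hF.isSmoothlySupportedFamily_polarBody hb hI
  refine ⟨fun t ht => (hF.isSmoothlySupported ht).isSmoothStrictlyConvexBody_polarBody (hb t ht),
    hF'.zero_mem_interior, (GaussFlow.contDiffOn_radialExt_supp_iff
      (K := fun t => GaussFlow.polarBody (K t))).2 hF'.contDiffOn_supp, fun t ht z hz => ?_⟩
  have hz1 : ‖z‖ = 1 := mem_sphere_zero_iff_norm.1 hz
  have hz0 : z ≠ 0 := norm_ne_zero_iff.1 (hz1 ▸ one_ne_zero)
  have hL := hF.isSmoothlySupported ht
  have hL' := hF'.isSmoothlySupported ht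
  have hpoint := hK.hasDerivWithinAt_supp ht (hL'.dualityMap_ne_zero hz0)
  refine (hF.hasDerivWithinAt_supp_polarBody hF' hI ht hz0 hpoint).congr_deriv ?_
  rw [hL.one_div_sigma_supp_dualityMap_polarBody hL' hz1, hL'.norm_dualityMap hz0,
    hL'.norm_gradient_supp hz1, mul_neg, neg_neg]

theorem mainTheorem2 (n : ℕ) (T : ℝ) (K : ℝ → Set (GaussFlow.E n))
    (hK : GaussFlow.EvolvesBy (fun s z => -(1 / GaussFlow.sigma s z)) T K) :
    GaussFlow.EvolvesBy
      (fun s z => s z ^ (n + 2) * GaussFlow.sigma s z /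
        (s z ^ 2 + ‖GaussFlow.sphGrad s z‖ ^ 2) ^ ((n : ℝ) / 2))
      T (fun t => GaussFlow.polarBody (K t)) := by
  simpa only [GaussFlow.mul_sqrt_mul_div_sqrt_pow_mul] using
    mainTheorem2_general n T K (fun r => r) hK
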